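/- Fix a countably infinite universe $\mathbb U$. A database schema is a finite nonempty set of relation symbols with arities in $\mathbb N$, and an instance over a schema is a finite set of facts $R(u_1,\dots,u_{\mathrm{ar}(R)})$ with $u_i\in\mathbb U$; its active domain $\mathrm{adom}(D)$ is the set of elements of $\mathbb U$ that occur in its facts. A probabilistic database (PDB) over a schema is a discrete probability space whose sample space is a set of instances over that schema; its possible worlds are the instances of positive probability, and its facts are the facts that occur in some possible world. A PDB is tuple-independent (class $\mathsf{TI}$) if $\Pr(f_1\in I,\dots,f_k\in I)=\prod_{i=1}^k\Pr(f_i\in I)$ for all pairwise distinct facts $f_1,\dots,f_k$ of it. It is block-independent disjoint (class $\mathsf{BID}$) if its facts can be partitioned into blocks such that this product formula holds for all facts $f_1,\dots,f_k$ from pairwise different blocks, and $\Pr(f\in I\text{ and }f'\in I)=0$ for all distinct facts $f,f'$ of the same block. An $\mathsf{FO}$-view consists of one first-order formula (possibly with constants from $\mathbb U$) over the input schema for each relation symbol $R$ of the output schema, with exactly $\mathrm{ar}(R)$ free variables in a fixed order, evaluated under the active domain semantics: quantifiers and answer tuples range over the elements of $\mathbb U$ that occur in the instance or as constants in the formula.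 It is a $\mathsf{UCQ}$-view if all its formulae are built from relational atoms $R(t_1,\dots,t_k)$ and equality atoms $x=t$ (each $t_i$, $t$ a variable or a constant) using only $\exists$, $\wedge$ and $\vee$. For a class $\mathsf D$ of PDBs, $\mathsf{FO}(\mathsf D)$ and $\mathsf{UCQ}(\mathsf D)$ denote the classes of images (push-forwards) of PDBs in $\mathsf D$ under $\mathsf{FO}$-views and $\mathsf{UCQ}$-views, respectively. Then $$\mathsf{UCQ}(\mathsf{BID})\subsetneq\mathsf{FO}(\mathsf{BID}).$$ Moreover, there is a PDB $\mathcal D$ over the schema with a single unary relation symbol such that $\mathcal D\in\mathsf{FO}(\mathsf{TI})$ and $\mathcal D\notin\mathsf{UCQ}(\mathsf{BID})$, where $\mathcal D$ is domain-disjoint, i.e. distinct instances of its sample space have disjoint active domains, and the possible worlds of $\mathcal D$ are pairwise distinct instances $D_1,D_2,\dots$ with $|D_n|\ge n$ for all $n\ge 1$. -/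

import Mathlib

open scoped ENNReal

namespace ProbDB

/-- A database schema: a finite nonempty set of relation symbols with arities. -/
structure Schema where
  Rel : Type
  ar : Rel → ℕ
  finite_rel : Finite Rel
  nonempty_rel : Nonempty Rel

attribute [instance] Schema.finite_rel Schema.nonempty_rel

/-- A fact `R(u₁, …, u_{ar R})` over the universe `U`. -/
@[ext]
structure DBFact (U : Type*) (τ : Schema) where
  rel : τ.Rel
  args : Fin (τ.ar rel) → U

/-- A database instance: a finite set of facts. -/
abbrev DBInstance (U : Type*) (τ : Schema) := Finset (DBFact U τ)

/-- The active domain of an instance. -/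
def adom {U : Type*} {τ : Schema} (D : DBInstance U τ) : Set U :=
  ⋃ f ∈ D, Set.range f.args

theorem finite_adom {U : Type*} {τ : Schema} (D : DBInstance U τ) : (adom D).Finite :=
  D.finite_toSet.biUnion fun f _ => Set.finite_range f.args

/-- Terms are variables (named by natural numbers) or constants from the universe. -/
inductive Term (U : Type*) where
  | var : ℕ → Term U
  | const : U → Term U

namespace Term

variable {U : Type*}

/-- The value of a term under a valuation of the variables. -/
def val (v : ℕ → U) : Term U → U
  | var x => v x
  | const a => a

/-- The variables of a term. -/
def vars : Term U → Set ℕ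
  | var x => {x}
  | const _ => ∅

/-- The constants of a term. -/
def consts : Term U → Set U
  | var _ => ∅
  | const a => {a}

theorem finite_consts (t : Term U) : t.consts.Finite := by
  cases t <;> simp [consts]

end Term

/-- First-order formulae over the schema `τ`, with constants from the universe `U`, built from
relational atoms `R(t₁, …, t_k)` and equality atoms `x = t`. -/
inductive FOFormula (U : Type*) (τ : Schema) where
  | atom (R : τ.Rel) (t : Fin (τ.ar R) → Term U) : FOFormula U τ
  | eq (x : ℕ) (t : Term U) : FOFormula U τ
  | not (φ : FOFormula U τ) : FOFormula U τ
  | and (φ ψ : FOFormula U τ) : FOFormula U τ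
  | or (φ ψ : FOFormula U τ) : FOFormula U τ
  | ex (x : ℕ) (φ : FOFormula U τ) : FOFormula U τ
  | all (x : ℕ) (φ : FOFormula U τ) : FOFormula U τ

namespace FOFormula

variable {U : Type*} {τ : Schema}

/-- The free variables of a formula. -/
def free : FOFormula U τ → Set ℕ
  | atom _ t => ⋃ i, (t i).vars
  | eq x t => {x} ∪ t.vars
  | not φ => φ.free
  | and φ ψ => φ.free ∪ ψ.free
  | or φ ψ => φ.free ∪ ψ.free
  | ex x φ => φ.free \ {x}
  | all x φ => φ.free \ {x}

/-- The constants appearing in a formula. -/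
def consts : FOFormula U τ → Set U
  | atom _ t => ⋃ i, (t i).consts
  | eq _ t => t.consts
  | not φ => φ.consts
  | and φ ψ => φ.consts ∪ ψ.consts
  | or φ ψ => φ.consts ∪ ψ.consts
  | ex _ φ => φ.consts
  | all _ φ => φ.consts

theorem finite_consts (φ : FOFormula U τ) : φ.consts.Finite := by
  induction φ with
  | atom R t => exact Set.finite_iUnion fun i => (t i).finite_consts
  | eq x t => exact t.finite_consts
  | not φ ih => exact ih
  | and φ ψ ih₁ ih₂ => exact ih₁.union ih₂
  | or φ ψ ih₁ ih₂ => exact ih₁.union ih₂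
  | ex x φ ih => exact ih
  | all x φ ih => exact ih

/-- Satisfaction of a formula in the instance `D` under the valuation `v`, where the quantifiers
range over `A`. -/
def Holds (A : Set U) (D : DBInstance U τ) : FOFormula U τ → (ℕ → U) → Prop
  | atom R t, v => (⟨R, fun i => (t i).val v⟩ : DBFact U τ) ∈ D
  | eq x t, v => v x = t.val v
  | not φ, v => ¬ φ.Holds A D v
  | and φ ψ, v => φ.Holds A D v ∧ ψ.Holds A D v
  | or φ ψ, v => φ.Holds A D v ∨ ψ.Holds A D v
  | ex x φ, v => ∃ a ∈ A, φ.Holds A D (Function.update v x a)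
  | all x φ, v => ∀ a ∈ A, φ.Holds A D (Function.update v x a)

/-- The active domain `adom(D, φ)`: the elements of `D` together with the constants of `φ`. -/
def adomWith (D : DBInstance U τ) (φ : FOFormula U τ) : Set U :=
  adom D ∪ φ.consts

/-- The relational calculus answer of `φ = φ(x₁, …, x_n)` on `D` under the active domain semantics:
all tuples over `adom(D, φ)` that satisfy `φ`, with quantifiers ranging over `adom(D, φ)`. -/
def answer (φ : FOFormula U τ) {n : ℕ} (x : Fin n → ℕ) (D : DBInstance U τ) :
    Set (Fin n → U) :=
  {a | (∀ i, a i ∈ adomWith D φ) ∧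
    ∃ v : ℕ → U, (∀ i, v (x i) = a i) ∧ φ.Holds (adomWith D φ) D v}

theorem finite_answer (φ : FOFormula U τ) {n : ℕ} (x : Fin n → ℕ) (D : DBInstance U τ) :
    (φ.answer x D).Finite :=
  (Set.Finite.pi' fun _ : Fin n => (finite_adom D).union φ.finite_consts).subset
    fun _ ha => ha.1

/-- The formulae built from atoms by using only `∃`, `∧` and `∨`
(unions of conjunctive queries). -/
def IsUCQ : FOFormula U τ → Prop
  | atom _ _ => True
  | eq _ _ => True
  | not _ => False
  | and φ ψ => φ.IsUCQ ∧ ψ.IsUCQ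
  | or φ ψ => φ.IsUCQ ∧ ψ.IsUCQ
  | ex _ φ => φ.IsUCQ
  | all _ _ => False

end FOFormula

/-- A first-order view from the input schema `σ` to the output schema `τ`: for every `R` in `τ`
a formula `φ_R(x₁, …, x_{ar R})` over `σ`, whose free variables are exactly the pairwise distinct
variables `x₁, …, x_{ar R}`. -/
structure FOView (U : Type*) (σ τ : Schema) where
  formula : τ.Rel → FOFormula U σ
  vars : ∀ R : τ.Rel, Fin (τ.ar R) → ℕ
  vars_injective : ∀ R, Function.Injective (vars R)
  range_vars : ∀ R, Set.range (vars R) = (formula R).free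

namespace FOView

variable {U : Type*} {σ τ : Schema}

theorem finite_result (V : FOView U σ τ) (D : DBInstance U σ) :
    {f : DBFact U τ | f.args ∈ (V.formula f.rel).answer (V.vars f.rel) D}.Finite := by
  refine (Set.finite_iUnion fun R : τ.Rel =>
    ((V.formula R).finite_answer (V.vars R) D).image fun a => (⟨R, a⟩ : DBFact U τ)).subset ?_
  intro f hf
  exact Set.mem_iUnion.2 ⟨f.rel, f.args, hf, rfl⟩

/-- The output instance of a view. -/
noncomputable def apply (V : FOView U σ τ) (D : DBInstance U σ) : DBInstance U τ :=
  (V.finite_result D).toFinset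

/-- A UCQ-view is a view all of whose formulae are unions of conjunctive queries. -/
def IsUCQ (V : FOView U σ τ) : Prop :=
  ∀ R, (V.formula R).IsUCQ

end FOView

/-- A probabilistic database: a set `space` of instances (the sample space) with a discrete
probability distribution on it. -/
structure PDB (U : Type*) (τ : Schema) where
  space : Set (DBInstance U τ)
  law : PMF (DBInstance U τ)
  support_subset : law.support ⊆ space

namespace PDB

variable {U : Type*} {σ τ : Schema}

/-- The probability of an event. -/
noncomputable def prob (D : PDB U τ) (E : Set (DBInstance U τ)) : ℝ≥0∞ :=
  D.law.toOuterMeasure E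

/-- The possible worlds: the instances of positive probability. -/
def worlds (D : PDB U τ) : Set (DBInstance U τ) :=
  {I | D.law I ≠ 0}

/-- The facts appearing in the possible worlds. -/
def facts (D : PDB U τ) : Set (DBFact U τ) :=
  {f | ∃ I ∈ D.worlds, f ∈ I}

/-- Tuple-independence: for pairwise distinct facts `f₁, …, f_k` the events `fᵢ ∈ I` satisfy the
product formula. -/
def IsTI (D : PDB U τ) : Prop :=
  ∀ F : Finset (DBFact U τ), (F : Set (DBFact U τ)) ⊆ D.facts →
    D.prob {I | F ⊆ I} = ∏ f ∈ F, D.prob {I | f ∈ I}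

/-- Block-independent disjointness: the facts are partitioned into blocks such that facts from
pairwise different blocks satisfy the product formula, and two distinct facts of the same block
almost surely do not occur together. -/
def IsBID (D : PDB U τ) : Prop :=
  ∃ 𝓑 : Set (Set (DBFact U τ)),
    (∅ ∉ 𝓑 ∧ 𝓑.PairwiseDisjoint id ∧ ⋃₀ 𝓑 = D.facts) ∧
    (∀ F : Finset (DBFact U τ), (F : Set (DBFact U τ)) ⊆ D.facts →
      (∀ B ∈ 𝓑, ((F : Set (DBFact U τ)) ∩ B).Subsingleton) →
      D.prob {I | F ⊆ I} = ∏ f ∈ F, D.prob {I | f ∈ I}) ∧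
    (∀ B ∈ 𝓑, ∀ f ∈ B, ∀ g ∈ B, f ≠ g → D.prob {I | f ∈ I ∧ g ∈ I} = 0)

/-- Distinct instances of the sample space have disjoint active domains. -/
def IsDomainDisjoint (D : PDB U τ) : Prop :=
  ∀ I ∈ D.space, ∀ J ∈ D.space, I ≠ J → Disjoint (adom I) (adom J)

/-- `D'` is the image of `D` under `V`, viewed as a map from the sample space of `D` to that
of `D'`. -/
def IsImage (V : DBInstance U σ → DBInstance U τ) (D : PDB U σ) (D' : PDB U τ) : Prop :=
  Set.MapsTo V D.space D'.space ∧ ∀ J ∈ D'.space, D'.law J = D.prob {I ∈ D.space | V I = J}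

end PDB

/-- Classes of PDBs over the universe `U`; the schema is arbitrary. -/
abbrev PDBClass (U : Type*) := Set (Σ τ : Schema, PDB U τ)

/-- The class of tuple-independent PDBs. -/
def TI (U : Type*) : PDBClass U := {D | D.2.IsTI}

/-- The class of block-independent disjoint PDBs. -/
def BID (U : Type*) : PDBClass U := {D | D.2.IsBID}

/-- `FO(𝓒)`: the images of PDBs of class `𝓒` under first-order views. -/
def FO {U : Type*} (𝓒 : PDBClass U) : PDBClass U :=
  {D | ∃ I ∈ 𝓒, ∃ V : FOView U I.1 D.1, PDB.IsImage V.apply I.2 D.2}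

/-- `UCQ(𝓒)`: the images of PDBs of class `𝓒` under UCQ-views. -/
def UCQ {U : Type*} (𝓒 : PDBClass U) : PDBClass U :=
  {D | ∃ I ∈ 𝓒, ∃ V : FOView U I.1 D.1, V.IsUCQ ∧ PDB.IsImage V.apply I.2 D.2}

/-- The schema that consists of a single unary relation symbol. -/
def unarySchema : Schema where
  Rel := Unit
  ar := fun _ => 1
  finite_rel := inferInstance
  nonempty_rel := inferInstance

end ProbDB

/-! UCQ-views are monotone, whereas an FO-view can test whether its input is complete. For the
negative part, a block of a BID PDB that is absent with positive probability is absent independently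
of all other facts, so deleting its facts from a possible world leaves a possible world. The
remaining blocks hit every world almost surely; since a fixed world holds at most one fact per
block, there are only finitely many of them. Hence every world contains a world of size at most some
`k` (`IsBID.exists_bounded_subworld`). A UCQ-view maps that subworld into the output of the larger
one. If outputs are nonempty and domain-disjoint, the two outputs coincide, and their size is
bounded in terms of `k`. Unbounded outputs are thus impossible (`notMem_UCQ_BID`). For the positive
part, `U` is split into cycles of lengths 1, 2, 3, …, and a TI PDB has all finite sets of edges as
worlds. Each edge carries the base point of its cycle, so a first-order sentence can recognize that
the facts form exactly one whole cycle. The view then outputs that cycle, and otherwise the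
one-element cycle. -/

namespace ProbDB

/-! ### Tuple-independent random finite sets -/

section RandomFinset

variable {α : Type*}

/-- The sum is the expansion of `∏ (1 + q a)`, which converges when `∑ q a` does. -/
theorem tsum_finset_prod_ne_top {q : α → ℝ≥0∞} (hq : ∑' a, q a ≠ ∞) :
    ∑' S : Finset α, ∏ a ∈ S, q a ≠ ∞ := by
  have hfin : ∀ a, q a ≠ ∞ := ENNReal.ne_top_of_tsum_ne_top hq
  lift q to α → NNReal using hfin
  have hs : Summable fun a => (q a : ℝ) :=
    NNReal.summable_coe.2 (ENNReal.tsum_coe_ne_top_iff_summable.1 hq)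
  have h := summable_finsetProd_of_summable_nonneg (fun a => (q a).coe_nonneg) hs
  have h' : Summable fun S : Finset α => ∏ a ∈ S, q a := by
    rw [← NNReal.summable_coe]; simpa using h
  have := ENNReal.tsum_coe_ne_top_iff_summable.2 h'
  simpa using this

theorem tsum_finset_prod_ne_zero (q : α → ℝ≥0∞) : ∑' S : Finset α, ∏ a ∈ S, q a ≠ 0 := by
  intro h
  simpa using ENNReal.tsum_eq_zero.1 h ∅

/-- The random finite set in which `S` has probability proportional to the product of the
weights of its elements. -/
noncomputable def finsetPMF (q : α → ℝ≥0∞) (hq : ∑' a, q a ≠ ∞) : PMF (Finset α) :=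
  PMF.normalize (fun S => ∏ a ∈ S, q a) (tsum_finset_prod_ne_zero q) (tsum_finset_prod_ne_top hq)

theorem finsetPMF_apply_ne_zero_iff {q : α → ℝ≥0∞} (hq : ∑' a, q a ≠ ∞) (S : Finset α) :
    finsetPMF q hq S ≠ 0 ↔ ∀ a ∈ S, q a ≠ 0 := by
  rw [← PMF.mem_support_iff, finsetPMF, PMF.mem_support_normalize_iff, Finset.prod_ne_zero_iff]

theorem finsetPMF_insert [DecidableEq α] {q : α → ℝ≥0∞} (hq : ∑' a, q a ≠ ∞) {a : α}
    {S : Finset α} (ha : a ∉ S) : finsetPMF q hq (insert a S) = q a * finsetPMF q hq S := by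
  simp only [finsetPMF, PMF.normalize_apply, Finset.prod_insert ha, mul_assoc]

/-- Inserting `a` is a bijection from the sets avoiding `a` to those containing it and multiplies
each weight by `q a`. So the odds of `a` are `q a : 1`, whatever `F` is. -/
theorem finsetPMF_insert_subset [DecidableEq α] {q : α → ℝ≥0∞} (hq : ∑' a, q a ≠ ∞) {a : α}
    {F : Finset α} (ha : a ∉ F) :
    (finsetPMF q hq).toOuterMeasure {S | insert a F ⊆ S} =
      q a * (1 + q a)⁻¹ * (finsetPMF q hq).toOuterMeasure {S | F ⊆ S} := by
  set p := finsetPMF q hq with hp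
  have hqa : q a ≠ ∞ := ENNReal.ne_top_of_tsum_ne_top hq a
  have h1 : p.toOuterMeasure {S | insert a F ⊆ S} =
      q a * p.toOuterMeasure {S | F ⊆ S ∧ a ∉ S} := by
    rw [PMF.toOuterMeasure_apply, PMF.toOuterMeasure_apply, ← tsum_subtype, ← tsum_subtype,
      ← ENNReal.tsum_mul_left]
    symm
    let e : {S : Finset α | F ⊆ S ∧ a ∉ S} ≃ {S : Finset α | insert a F ⊆ S} :=
      { toFun := fun S => ⟨insert a S.1, Finset.insert_subset_insert a S.2.1⟩
        invFun := fun S => ⟨S.1.erase a, Finset.subset_erase.2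
          ⟨(Finset.subset_insert a F).trans S.2, ha⟩, Finset.notMem_erase a _⟩
        left_inv := fun S => Subtype.ext (Finset.erase_insert S.2.2)
        right_inv := fun S => Subtype.ext
          (Finset.insert_erase (S.2 (Finset.mem_insert_self a F))) }
    rw [← e.tsum_eq]
    exact tsum_congr fun S => (finsetPMF_insert hq S.2.2).symm
  have h2 : p.toOuterMeasure {S | F ⊆ S} =
      p.toOuterMeasure {S | insert a F ⊆ S} + p.toOuterMeasure {S | F ⊆ S ∧ a ∉ S} := by
    simp only [PMF.toOuterMeasure_apply, ← ENNReal.tsum_add]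
    refine tsum_congr fun S => ?_
    by_cases hF : F ⊆ S <;> by_cases haS : a ∈ S <;>
      simp [hF, haS, Finset.insert_subset_iff]
  rw [h2, h1]
  set x := p.toOuterMeasure {S | F ⊆ S ∧ a ∉ S}
  have h3 : q a * x + x = (1 + q a) * x := by ring
  have h4 : (1 + q a)⁻¹ * (1 + q a) = 1 := ENNReal.inv_mul_cancel (by simp) (by simp [hqa])
  rw [h3, mul_assoc, ← mul_assoc _ _ x, h4, one_mul]

theorem finsetPMF_subset {q : α → ℝ≥0∞} (hq : ∑' a, q a ≠ ∞) (F : Finset α) :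
    (finsetPMF q hq).toOuterMeasure {S | F ⊆ S} =
      ∏ a ∈ F, (finsetPMF q hq).toOuterMeasure {S | a ∈ S} := by
  classical
  have huniv : (finsetPMF q hq).toOuterMeasure {S | ∅ ⊆ S} = 1 :=
    (PMF.toOuterMeasure_apply_eq_one_iff _ _).2 fun _ _ => Finset.empty_subset _
  induction F using Finset.induction_on with
  | empty => simpa using huniv
  | insert a F ha ih =>
    rw [finsetPMF_insert_subset hq ha, ih, Finset.prod_insert ha]
    -- The case `F = ∅` identifies the factor `q a / (1 + q a)` as the marginal of `a`.
    have h := finsetPMF_insert_subset hq (Finset.notMem_empty a)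
    rw [huniv, mul_one] at h
    rw [← h]
    simp

end RandomFinset

end ProbDB

/-! ### Small subworlds in BID PDBs -/

namespace ProbDB

instance {U : Type*} {τ : Schema} [Countable U] : Countable (DBFact U τ) := by
  have : Function.Injective fun f : DBFact U τ => (⟨f.rel, f.args⟩ : Σ R : τ.Rel, Fin (τ.ar R) → U) := by
    rintro ⟨R, a⟩ ⟨S, b⟩ h
    cases h
    rfl
  exact this.countable

namespace PDB

variable {U : Type*} {τ : Schema}

theorem mem_worlds_of_prob_ne_zero {D : PDB U τ} {E : Set (DBInstance U τ)} (h : D.prob E ≠ 0) :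
    ∃ I ∈ D.worlds, I ∈ E := by
  rw [prob, Ne, PMF.toOuterMeasure_apply_eq_zero_iff, Set.not_disjoint_iff] at h
  exact h

theorem prob_ne_zero {D : PDB U τ} {E : Set (DBInstance U τ)} {I : DBInstance U τ}
    (hI : I ∈ D.worlds) (hE : I ∈ E) : D.prob E ≠ 0 := by
  rw [prob, Ne, PMF.toOuterMeasure_apply_eq_zero_iff, Set.not_disjoint_iff]
  exact ⟨I, hI, hE⟩

/-- The event that some fact of `B` is present. -/
def hits (U : Type*) (τ : Schema) (B : Set (DBFact U τ)) : Set (DBInstance U τ) :=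
  {I | ∃ f ∈ B, f ∈ I}

/-- The family of blocks `𝓑` witnesses that the PDB is block-independent disjoint. -/
structure IsBlocks (D : PDB U τ) (𝓑 : Set (Set (DBFact U τ))) : Prop where
  disj : 𝓑.PairwiseDisjoint id
  cover : ⋃₀ 𝓑 = D.facts
  indep : ∀ F : Finset (DBFact U τ), (F : Set (DBFact U τ)) ⊆ D.facts →
    (∀ B ∈ 𝓑, ((F : Set (DBFact U τ)) ∩ B).Subsingleton) →
    D.prob {I | F ⊆ I} = ∏ f ∈ F, D.prob {I | f ∈ I}
  excl : ∀ B ∈ 𝓑, ∀ f ∈ B, ∀ g ∈ B, f ≠ g → D.prob {I | f ∈ I ∧ g ∈ I} = 0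

namespace IsBlocks

variable {D : PDB U τ} {𝓑 : Set (Set (DBFact U τ))}

/-- If `F` contains a non-fact or two facts of one block, both sides vanish; otherwise the product
formula applies to `F` and to `insert f F`. -/
theorem prob_mem_and_subset (h : D.IsBlocks 𝓑) {B : Set (DBFact U τ)} (hB : B ∈ 𝓑)
    {f : DBFact U τ} (hf : f ∈ B) {F : Finset (DBFact U τ)}
    (hF : Disjoint (F : Set (DBFact U τ)) B) :
    D.prob {I | f ∈ I ∧ F ⊆ I} = D.prob {I | f ∈ I} * D.prob {I | F ⊆ I} := by
  classical
  have hzero : D.prob {I | F ⊆ I} = 0 →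
      D.prob {I | f ∈ I ∧ F ⊆ I} = D.prob {I | f ∈ I} * D.prob {I | F ⊆ I} := by
    intro h0
    rw [h0, mul_zero]
    by_contra hne
    obtain ⟨I, hI, hI'⟩ := mem_worlds_of_prob_ne_zero hne
    exact prob_ne_zero hI (E := {I | F ⊆ I}) hI'.2 h0
  by_cases h1 : (F : Set (DBFact U τ)) ⊆ D.facts
  swap
  · apply hzero
    by_contra hne
    obtain ⟨I, hI, hI'⟩ := mem_worlds_of_prob_ne_zero hne
    exact h1 fun g hg => ⟨I, hI, hI' hg⟩
  by_cases h2 : ∀ B ∈ 𝓑, ((F : Set (DBFact U τ)) ∩ B).Subsingleton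
  swap
  · apply hzero
    by_contra hne
    obtain ⟨I, hI, hI'⟩ := mem_worlds_of_prob_ne_zero hne
    push Not at h2
    obtain ⟨C, hC, x, hx, y, hy, hxy⟩ := h2
    exact prob_ne_zero hI (E := {I | x ∈ I ∧ y ∈ I}) ⟨hI' hx.1, hI' hy.1⟩
      (h.excl C hC x hx.2 y hy.2 hxy)
  have hfF : f ∉ F := fun hfF => Set.disjoint_left.1 hF hfF hf
  have hff : f ∈ D.facts := h.cover ▸ Set.mem_sUnion_of_mem hf hB
  have h3 := h.indep (insert f F)
    (by rw [Finset.coe_insert]; exact Set.insert_subset hff h1) (by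
      intro C hC
      by_cases hCB : C = B
      · subst hCB
        have : ((insert f F : Finset _) : Set (DBFact U τ)) ∩ C ⊆ {f} := by
          rintro x ⟨hx, hxC⟩
          rcases Finset.mem_insert.1 (Finset.mem_coe.1 hx) with rfl | hx
          · rfl
          · exact (Set.disjoint_left.1 hF hx hxC).elim
        exact Set.subsingleton_singleton.anti this
      · refine (h2 C hC).anti ?_
        rintro x ⟨hx, hxC⟩
        rcases Finset.mem_insert.1 (Finset.mem_coe.1 hx) with rfl | hx
        · exact (Set.disjoint_left.1 (h.disj hC hB hCB) hxC hf).elim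
        · exact ⟨hx, hxC⟩)
  rw [Finset.prod_insert hfF, ← h.indep F h1 h2] at h3
  simpa only [Finset.insert_subset_iff] using h3

open MeasureTheory ProbabilityTheory in
theorem prob_hits_inter_subset [Countable U] (h : D.IsBlocks 𝓑) {B : Set (DBFact U τ)}
    (hB : B ∈ 𝓑) {F : Finset (DBFact U τ)} (hF : Disjoint (F : Set (DBFact U τ)) B) :
    D.prob (hits U τ B ∩ {I | F ⊆ I}) = D.prob (hits U τ B) * D.prob {I | F ⊆ I} := by
  let _ : MeasurableSpace (DBInstance U τ) := ⊤
  have hp : ∀ E, D.prob E = D.law.toMeasure E := fun E =>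
    (D.law.toMeasure_apply_eq_toOuterMeasure_apply trivial).symm
  have key : ∀ E : Set (DBInstance U τ),
      D.prob (hits U τ B ∩ E) = ∑' f : B, D.prob {I | f.1 ∈ I ∧ I ∈ E} := by
    intro E
    simp only [hp]
    -- Facts of one block exclude each other almost surely, so countable additivity applies.
    rw [← measure_iUnion₀]
    · congr 1
      ext I
      simp only [hits, Set.mem_inter_iff, Set.mem_ofPred_eq, Set.mem_iUnion, Subtype.exists]
      constructor
      · rintro ⟨⟨f, hf, hfI⟩, hE⟩
        exact ⟨f, hf, hfI, hE⟩
      · rintro ⟨f, hf, hfI, hE⟩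
        exact ⟨⟨f, hf, hfI⟩, hE⟩
    · intro f g hfg
      refine measure_mono_null (t := {I | f.1 ∈ I ∧ g.1 ∈ I}) (fun I hI => ⟨hI.1.1, hI.2.1⟩) ?_
      rw [← hp]
      exact h.excl B hB f f.2 g g.2 (Subtype.coe_injective.ne hfg)
    · exact fun _ => MeasurableSet.nullMeasurableSet trivial
  have key' := key Set.univ
  simp only [Set.inter_univ, Set.mem_univ, and_true] at key'
  rw [key, key', ← ENNReal.tsum_mul_right]
  exact tsum_congr fun f => h.prob_mem_and_subset hB f.2 hF

-- The events `F ⊆ I` with `F` disjoint from `B` form a π-system, so independence extends to the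
-- σ-algebra they generate. As there are countably many facts, that σ-algebra contains the event
-- prescribing the whole instance outside `B`.
open MeasureTheory ProbabilityTheory in
theorem prob_not_hits_inter [Countable U] (h : D.IsBlocks 𝓑) {B : Set (DBFact U τ)}
    (hB : B ∈ 𝓑) (X : Set (DBFact U τ)) :
    D.prob ((hits U τ B)ᶜ ∩ {I : DBInstance U τ | (I : Set (DBFact U τ)) \ B = X}) =
      D.prob (hits U τ B)ᶜ * D.prob {I : DBInstance U τ | (I : Set (DBFact U τ)) \ B = X} := by
  classical
  let _ : MeasurableSpace (DBInstance U τ) := ⊤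
  have hp : ∀ E, D.prob E = D.law.toMeasure E := fun E =>
    (D.law.toMeasure_apply_eq_toOuterMeasure_apply trivial).symm
  let p2 : Set (Set (DBInstance U τ)) :=
    {E | ∃ F : Finset (DBFact U τ), Disjoint (F : Set (DBFact U τ)) B ∧ E = {I | F ⊆ I}}
  have hp2 : IsPiSystem p2 := by
    rintro _ ⟨F, hF, rfl⟩ _ ⟨G, hG, rfl⟩ -
    refine ⟨F ∪ G, ?_, ?_⟩
    · rw [Finset.coe_union]
      exact Disjoint.union_left hF hG
    · ext I
      simp [Finset.union_subset_iff]
  have hind := IndepSets.indep' (μ := D.law.toMeasure) (p1 := {hits U τ B}) (p2 := p2)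
    (fun _ _ => trivial) (fun _ _ => trivial) (IsPiSystem.singleton _) hp2 (by
      rw [IndepSets_iff]
      rintro _ _ rfl ⟨F, hF, rfl⟩
      simpa only [hp] using h.prob_hits_inter_subset hB hF)
  rw [Indep_iff] at hind
  simp only [hp]
  refine hind _ _ (MeasurableSet.compl (MeasurableSpace.measurableSet_generateFrom rfl)) ?_
  have hmem : ∀ f ∉ B, MeasurableSet[MeasurableSpace.generateFrom p2]
      {I : DBInstance U τ | f ∈ I} := by
    intro f hf
    refine MeasurableSpace.measurableSet_generateFrom ⟨{f}, ?_, ?_⟩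
    · simpa using hf
    · simp
  by_cases hX : Disjoint X B
  · have : {I : DBInstance U τ | (I : Set (DBFact U τ)) \ B = X} =
        ⋂ f : {f // f ∉ B}, if f.1 ∈ X then {I : DBInstance U τ | f.1 ∈ I} else
          {I : DBInstance U τ | f.1 ∈ I}ᶜ := by
      ext I
      simp only [Set.mem_ofPred_eq, Set.mem_iInter, Subtype.forall]
      constructor
      · rintro rfl f hf
        by_cases hfI : f ∈ I <;> simp [hf, hfI]
      · intro hI
        ext f
        by_cases hf : f ∈ B
        · have hfX : f ∉ X := fun hfX => Set.disjoint_left.1 hX hfX hf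
          simp [hf, hfX]
        · have := hI f hf
          by_cases hfX : f ∈ X
          · simp only [hfX, if_true] at this
            simpa [hf, hfX] using this
          · simp only [hfX, if_false] at this
            simpa [hf, hfX] using this
    rw [this]
    refine @MeasurableSet.iInter _ _ (MeasurableSpace.generateFrom p2) _ _ fun f => ?_
    split_ifs
    · exact hmem f f.2
    · exact @MeasurableSet.compl _ _ (MeasurableSpace.generateFrom p2) (hmem f f.2)
  · have : {I : DBInstance U τ | (I : Set (DBFact U τ)) \ B = X} = ∅ := by
      ext I
      simp only [Set.mem_ofPred_eq, Set.mem_empty_iff_false, iff_false]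
      rintro rfl
      exact hX Set.disjoint_sdiff_left
    rw [this]
    exact @MeasurableSet.empty _ (MeasurableSpace.generateFrom p2)

-- By independence some world avoids `B` and agrees with `I` outside `B`; it can only be the
-- filtered instance.
open Classical in
theorem filter_notMem_mem_worlds [Countable U] (h : D.IsBlocks 𝓑) {B : Set (DBFact U τ)}
    (hB : B ∈ 𝓑) (h0 : D.prob (hits U τ B)ᶜ ≠ 0) {I : DBInstance U τ} (hI : I ∈ D.worlds) :
    I.filter (· ∉ B) ∈ D.worlds := by
  have h1 : D.prob {J : DBInstance U τ | (J : Set (DBFact U τ)) \ B = (I : Set _) \ B} ≠ 0 :=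
    prob_ne_zero hI rfl
  have h2 := mul_ne_zero h0 h1
  rw [← h.prob_not_hits_inter hB] at h2
  obtain ⟨J, hJ, hJB, hJI⟩ := mem_worlds_of_prob_ne_zero h2
  convert hJ
  ext f
  have hfB : f ∈ J → f ∉ B := fun hfJ hfB => hJB ⟨f, hfB, hfJ⟩
  have := Set.ext_iff.1 hJI f
  simp only [Set.mem_sdiff, Finset.mem_coe] at this
  simp only [Finset.mem_filter]
  tauto

theorem exists_subworld_of_full_blocks [Countable U] (h : D.IsBlocks 𝓑) (I : DBInstance U τ)
    (hI : I ∈ D.worlds) : ∃ J ∈ D.worlds, J ⊆ I ∧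
      ∀ f ∈ J, ∃ B ∈ 𝓑, f ∈ B ∧ D.prob (hits U τ B)ᶜ = 0 := by
  classical
  induction I using Finset.strongInduction with
  | H I ih =>
    by_cases hfull : ∀ f ∈ I, ∃ B ∈ 𝓑, f ∈ B ∧ D.prob (hits U τ B)ᶜ = 0
    · exact ⟨I, hI, subset_rfl, hfull⟩
    · push Not at hfull
      obtain ⟨f, hf, hfB⟩ := hfull
      have hff : f ∈ D.facts := ⟨I, hI, hf⟩
      rw [← h.cover] at hff
      obtain ⟨B, hB, hfB'⟩ := hff
      have hlt : I.filter (· ∉ B) ⊂ I := Finset.filter_ssubset.2 ⟨f, hf, by simpa using hfB'⟩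
      obtain ⟨J, hJ, hJI, hJf⟩ := ih _ hlt (h.filter_notMem_mem_worlds hB (hfB B hB hfB') hI)
      exact ⟨J, hJ, hJI.trans hlt.1, hJf⟩

end IsBlocks

/-- In a BID PDB, the possible worlds contain possible worlds of bounded size. -/
theorem IsBID.exists_bounded_subworld [Countable U] {D : PDB U τ} (h : D.IsBID) :
    ∃ k : ℕ, ∀ I ∈ D.worlds, ∃ J ∈ D.worlds, J ⊆ I ∧ J.card ≤ k := by
  obtain ⟨𝓑, ⟨-, hd, hc⟩, hi, he⟩ := h
  have h : D.IsBlocks 𝓑 := ⟨hd, hc, hi, he⟩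
  obtain ⟨W, hW⟩ := D.law.support_nonempty
  refine ⟨W.card, fun I hI => ?_⟩
  obtain ⟨J, hJ, hJI, hJf⟩ := h.exists_subworld_of_full_blocks I hI
  refine ⟨J, hJ, hJI, ?_⟩
  -- Each block met by `J` also meets `W`. Sending a fact of `J` to a fact of `W` in its block is
  -- injective: blocks are disjoint, and the world `J` has at most one fact per block.
  choose! B hB hfB h0 using hJf
  have hhit : ∀ f ∈ J, ∃ g ∈ W, g ∈ B f := by
    intro f hf
    by_contra hno
    push Not at hno
    exact prob_ne_zero (E := (hits U τ (B f))ᶜ) hW (fun ⟨g, hg, hgW⟩ => hno g hgW hg) (h0 f hf)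
  choose! g hgW hgB using hhit
  refine Finset.card_le_card_of_injOn g hgW fun f hf f' hf' hff' => ?_
  have hBB : B f = B f' := by
    by_contra hne
    exact Set.disjoint_left.1 (hd (hB f hf) (hB f' hf') hne) (hgB f hf) (hff' ▸ hgB f' hf')
  by_contra hne
  exact prob_ne_zero (E := {I | f ∈ I ∧ f' ∈ I}) hJ ⟨hf, hf'⟩
    (he (B f) (hB f hf) f (hfB f hf) f' (hBB ▸ hfB f' hf') hne)

end PDB

end ProbDB

/-! ### Monotonicity of UCQ-views and the negative result -/

namespace ProbDB

variable {U : Type*} {σ τ : Schema}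

theorem adom_mono {D D' : DBInstance U τ} (h : D ⊆ D') : adom D ⊆ adom D' :=
  Set.biUnion_subset_biUnion_left h

theorem mem_adom {D : DBInstance U τ} {f : DBFact U τ} (hf : f ∈ D) (i : Fin (τ.ar f.rel)) :
    f.args i ∈ adom D :=
  Set.mem_biUnion hf ⟨i, rfl⟩

theorem FOFormula.IsUCQ.holds_mono {φ : FOFormula U σ} (hφ : φ.IsUCQ) {A A' : Set U}
    (hA : A ⊆ A') {D D' : DBInstance U σ} (hD : D ⊆ D') {v : ℕ → U} (h : φ.Holds A D v) :
    φ.Holds A' D' v := by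
  induction φ generalizing v with
  | atom R t => exact hD h
  | eq x t => exact h
  | not φ ih => exact hφ.elim
  | and φ ψ ih₁ ih₂ => exact ⟨ih₁ hφ.1 h.1, ih₂ hφ.2 h.2⟩
  | or φ ψ ih₁ ih₂ => exact h.imp (ih₁ hφ.1) (ih₂ hφ.2)
  | ex x φ ih =>
    obtain ⟨a, ha, h⟩ := h
    exact ⟨a, hA ha, ih hφ h⟩
  | all x φ ih => exact hφ.elim

namespace FOView

theorem mem_apply {V : FOView U σ τ} {D : DBInstance U σ} {f : DBFact U τ} :
    f ∈ V.apply D ↔ f.args ∈ (V.formula f.rel).answer (V.vars f.rel) D :=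
  Set.Finite.mem_toFinset _

theorem IsUCQ.apply_mono {V : FOView U σ τ} (hV : V.IsUCQ) {D D' : DBInstance U σ}
    (h : D ⊆ D') : V.apply D ⊆ V.apply D' := by
  intro f hf
  rw [mem_apply] at hf ⊢
  obtain ⟨h1, v, hv, h2⟩ := hf
  have hA : (V.formula f.rel).adomWith D ⊆ (V.formula f.rel).adomWith D' :=
    Set.union_subset_union_left _ (adom_mono h)
  exact ⟨fun i => hA (h1 i), v, hv, (hV f.rel).holds_mono hA h h2⟩

end FOView

theorem ncard_adom_le {m : ℕ} (hm : ∀ R, σ.ar R ≤ m) (D : DBInstance U σ) :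
    (adom D).ncard ≤ D.card * m := by
  classical
  have h : adom D = (D.biUnion fun f => Finset.univ.image f.args : Finset U) := by
    ext a
    simp [adom]
  rw [h, Set.ncard_coe_finset]
  refine Finset.card_biUnion_le_card_mul _ _ _ fun f _ => Finset.card_image_le.trans ?_
  simpa using hm f.rel

/-- The size of the output of a view into the unary schema is bounded in terms of the size of
the input. -/
theorem FOView.exists_card_apply_le (V : FOView U σ unarySchema) :
    ∃ b : ℕ → ℕ, Monotone b ∧ ∀ D, (V.apply D).card ≤ b D.card := by
  obtain ⟨m, hm⟩ := (Set.finite_range σ.ar).bddAbove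
  -- With arities at most `m`, `k` facts mention at most `k * m` elements; outputs may also use the
  -- constants of the formula.
  refine ⟨fun k => k * m + ((V.formula ()).consts).ncard, fun k l hkl => by
    dsimp only; gcongr, fun D => ?_⟩
  refine le_trans ?_ ((Set.ncard_union_le _ _).trans
    (Nat.add_le_add_right (ncard_adom_le (fun R => hm ⟨R, rfl⟩) D) _))
  rw [← Set.ncard_coe_finset]
  refine Set.ncard_le_ncard_of_injOn (fun f : DBFact U unarySchema => f.args (0 : Fin 1))
    (fun f hf => (mem_apply.1 hf).1 (0 : Fin 1)) ?_
    ((finite_adom D).union (V.formula ()).finite_consts)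
  rintro ⟨_, a⟩ _ ⟨_, b⟩ _ hab
  congr 1
  funext i
  have hi : i = (0 : Fin 1) := Subsingleton.elim (α := Fin 1) _ _
  rw [hi]
  exact hab

namespace PDB

theorem IsImage.apply_mem_worlds {V : DBInstance U σ → DBInstance U τ} {D : PDB U σ}
    {D' : PDB U τ} (h : IsImage V D D') {I : DBInstance U σ} (hI : I ∈ D.worlds) :
    V I ∈ D'.worlds := by
  have hs : I ∈ D.space := D.support_subset hI
  rw [worlds, Set.mem_ofPred_eq, h.2 _ (h.1 hs)]
  exact prob_ne_zero hI ⟨hs, rfl⟩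

theorem IsImage.exists_world {V : DBInstance U σ → DBInstance U τ} {D : PDB U σ}
    {D' : PDB U τ} (h : IsImage V D D') {J : DBInstance U τ} (hJ : J ∈ D'.worlds) :
    ∃ I ∈ D.worlds, V I = J := by
  have hs : J ∈ D'.space := D'.support_subset hJ
  rw [worlds, Set.mem_ofPred_eq, h.2 _ hs] at hJ
  obtain ⟨I, hI, -, hIJ⟩ := mem_worlds_of_prob_ne_zero hJ
  exact ⟨I, hI, hIJ⟩

/-- A domain-disjoint PDB with nonempty possible worlds of unbounded size is not the image of a
BID PDB under a UCQ-view. -/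
theorem notMem_UCQ_BID [Countable U] {D : PDB U unarySchema} (hD : D.IsDomainDisjoint)
    (hne : ∀ I ∈ D.worlds, I.Nonempty) (hub : ∀ k, ∃ I ∈ D.worlds, k < I.card) :
    (⟨unarySchema, D⟩ : Σ τ : Schema, PDB U τ) ∉ UCQ (BID U) := by
  rintro ⟨⟨σ, E⟩, hE, V, hV, hVD⟩
  obtain ⟨k, hk⟩ := IsBID.exists_bounded_subworld (D := E) hE
  obtain ⟨b, hb, hVb⟩ := V.exists_card_apply_le
  obtain ⟨J, hJ, hJk⟩ := hub (b k)
  obtain ⟨I, hI, rfl⟩ := hVD.exists_world hJ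
  obtain ⟨I', hI', hsub, hcard⟩ := hk I hI
  have hJ' := hVD.apply_mem_worlds hI'
  have hss := FOView.IsUCQ.apply_mono hV hsub
  -- The outputs are nested and the smaller is nonempty, so their active domains meet.
  have heq : V.apply I' = V.apply I := by
    by_contra hneq
    obtain ⟨f, hf⟩ := hne _ hJ'
    exact Set.disjoint_left.1 (hD _ (D.support_subset hJ') _ (D.support_subset hJ) hneq)
      (mem_adom hf (0 : Fin 1)) (mem_adom (hss hf) (0 : Fin 1))
  have := (hVb I').trans (hb hcard)
  rw [heq] at this
  exact absurd hJk this.not_gt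

theorem IsTI.isBID {D : PDB U τ} (h : D.IsTI) : D.IsBID := by
  refine ⟨(fun f => {f}) '' D.facts, ⟨?_, ?_, ?_⟩, fun F hF _ => h F hF, ?_⟩
  · rintro ⟨f, -, hf⟩
    exact Set.singleton_ne_empty f hf
  · rintro _ ⟨f, -, rfl⟩ _ ⟨g, -, rfl⟩ hfg
    exact Set.disjoint_singleton.2 fun h => hfg (by rw [h])
  · ext f
    simp
  · rintro _ ⟨f, -, rfl⟩ g rfl g' rfl hne
    exact (hne rfl).elim

end PDB

end ProbDB

/-! ### The cycle-recognizing view -/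

namespace ProbDB

/-- The schema that consists of a single ternary relation symbol. -/
def ternarySchema : Schema where
  Rel := Unit
  ar := fun _ => 3
  finite_rel := inferInstance
  nonempty_rel := inferInstance

namespace Cycles

open FOFormula

variable {U : Type*}

/-- The fact with arguments `a`, `b`, `c` over the ternary schema. -/
def fact (a b c : U) : DBFact U ternarySchema := ⟨(), ![a, b, c]⟩

/-- The fact with argument `a` over the unary schema. -/
def ufact (a : U) : DBFact U unarySchema := ⟨(), ![a]⟩

theorem ufact_injective : Function.Injective (ufact (U := U)) := by
  intro a b h
  have h' : (![a] : Fin 1 → U) = ![b] := eq_of_heq (DBFact.ext_iff.1 h).2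
  exact congrFun h' 0

theorem ufact_args (f : DBFact U unarySchema) : ufact (f.args (0 : Fin 1)) = f := by
  obtain ⟨_, a⟩ := f
  refine congrArg (DBFact.mk (τ := unarySchema) ()) (funext fun i => ?_)
  have hi : i = (0 : Fin 1) := Subsingleton.elim (α := Fin 1) _ _
  rw [hi]
  rfl

/-- The relational atom over the ternary schema with the variables `i`, `j`, `k`. -/
def rel (U : Type*) (i j k : ℕ) : FOFormula U ternarySchema :=
  .atom () ![Term.var i, Term.var j, Term.var k]

theorem holds_rel {A : Set U} {D : DBInstance U ternarySchema} {i j k : ℕ} {v : ℕ → U} :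
    (rel U i j k).Holds A D v ↔ fact (v i) (v j) (v k) ∈ D := by
  have : (fun t => ((![Term.var i, Term.var j, Term.var k] : Fin 3 → Term U) t).val v) =
      ![v i, v j, v k] := by
    funext t
    fin_cases t <;> rfl
  exact Iff.of_eq (congrArg (fun a => (⟨(), a⟩ : DBFact U ternarySchema) ∈ D) this)

theorem free_rel (i j k : ℕ) : (rel U i j k).free = {i, j, k} := by
  have : (⋃ t, ((![Term.var i, Term.var j, Term.var k] : Fin 3 → Term U) t).vars) = {i, j, k} := by
    ext x
    simp [Fin.exists_fin_succ, Term.vars]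
  exact this

theorem consts_rel (i j k : ℕ) : (rel U i j k).consts = ∅ := by
  have : (⋃ t, ((![Term.var i, Term.var j, Term.var k] : Fin 3 → Term U) t).consts) = ∅ := by
    ext x
    simp [Fin.forall_fin_succ, Term.consts]
  exact this

/-- The sentence saying that there is a fact, that all facts have the same third component, and
that the second component of every fact is the first component of some fact. -/
def closed (U : Type*) : FOFormula U ternarySchema :=
  .ex 1 (.and (.ex 2 (.ex 3 (rel U 2 3 1)))
    (.all 2 (.all 3 (.all 4 (.or (.not (rel U 2 3 4))
      (.and (.eq 4 (.var 1)) (.ex 5 (rel U 3 5 4))))))))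

/-- The formula defining the set of first components of facts if `closed` holds, and `{c}`
otherwise. -/
def select (c : U) : FOFormula U ternarySchema :=
  .or (.and (closed U) (.ex 1 (.ex 2 (rel U 0 1 2)))) (.and (.not (closed U)) (.eq 0 (.const c)))

theorem free_closed : (closed U).free = ∅ := by
  ext x
  simp [closed, free, free_rel, Term.vars]
  omega

theorem free_select (c : U) : (select c).free = {0} := by
  ext x
  simp [select, free, free_closed, free_rel, Term.vars]
  omega

theorem consts_select (c : U) : (select c).consts = {c} := by
  ext x
  simp [select, closed, consts, consts_rel, Term.consts]

theorem fact_mem_adom {D : DBInstance U ternarySchema} {a b c : U} (h : fact a b c ∈ D) :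
    a ∈ adom D ∧ b ∈ adom D ∧ c ∈ adom D :=
  ⟨mem_adom h (0 : Fin 3), mem_adom h (1 : Fin 3), mem_adom h (2 : Fin 3)⟩

/-- Every witness occurs in a fact, so restricting the quantifiers to `A` changes nothing. -/
theorem holds_closed {A : Set U} {D : DBInstance U ternarySchema} (hA : adom D ⊆ A) {v : ℕ → U} :
    (closed U).Holds A D v ↔ ∃ z, (∃ x y, fact x y z ∈ D) ∧
      ∀ x y z', fact x y z' ∈ D → z' = z ∧ ∃ w, fact y w z' ∈ D := by
  simp only [closed, Holds, holds_rel, Term.val, Function.update_self, ne_eq,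
    Function.update_of_ne, Nat.reduceEqDiff, not_false_eq_true,
    OfNat.one_ne_ofNat, ← imp_iff_not_or]
  constructor
  · rintro ⟨z, -, ⟨x, -, y, -, h⟩, h'⟩
    refine ⟨z, ⟨x, y, h⟩, fun x y z' hf => ?_⟩
    have hm := fact_mem_adom hf
    obtain ⟨h1, w, -, h2⟩ := h' x (hA hm.1) y (hA hm.2.1) z' (hA hm.2.2) hf
    exact ⟨h1, w, h2⟩
  · rintro ⟨z, ⟨x, y, h⟩, h'⟩
    have hm := fact_mem_adom h
    refine ⟨z, hA hm.2.2, ⟨x, hA hm.1, y, hA hm.2.1, h⟩, fun x _ y _ z' _ hf => ?_⟩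
    obtain ⟨h1, w, h2⟩ := h' x y z' hf
    exact ⟨h1, w, hA (fact_mem_adom h2).2.1, h2⟩

/-- The view from the ternary to the unary schema given by the formula `select c`. -/
def view (c : U) : FOView U ternarySchema unarySchema where
  formula _ := select c
  vars _ _ := 0
  vars_injective _ := fun i j _ => Subsingleton.elim (α := Fin 1) i j
  range_vars _ := by
    rw [free_select]
    exact Set.range_const (ι := Fin 1)

theorem ufact_mem_view {c : U} {D : DBInstance U ternarySchema} {a : U} :
    ufact a ∈ (view c).apply D ↔
      ((∃ z, (∃ x y, fact x y z ∈ D) ∧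
        ∀ x y z', fact x y z' ∈ D → z' = z ∧ ∃ w, fact y w z' ∈ D) ∧ ∃ y z, fact a y z ∈ D) ∨
      ((¬ ∃ z, (∃ x y, fact x y z ∈ D) ∧
        ∀ x y z', fact x y z' ∈ D → z' = z ∧ ∃ w, fact y w z' ∈ D) ∧ a = c) := by
  have hA : adom D ⊆ (select c).adomWith D := Set.subset_union_left
  have hc : c ∈ (select c).adomWith D := Or.inr (by rw [consts_select]; rfl)
  rw [FOView.mem_apply]
  change ((∀ i : Fin 1, (![a] : Fin 1 → U) i ∈ (select c).adomWith D) ∧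
    ∃ v : ℕ → U, (∀ i : Fin 1, v 0 = (![a] : Fin 1 → U) i) ∧
      (select c).Holds ((select c).adomWith D) D v) ↔ _
  simp only [Fin.forall_fin_one, Matrix.cons_val_zero]
  have hholds : ∀ v : ℕ → U, (select c).Holds ((select c).adomWith D) D v ↔
      ((∃ z, (∃ x y, fact x y z ∈ D) ∧
        ∀ x y z', fact x y z' ∈ D → z' = z ∧ ∃ w, fact y w z' ∈ D) ∧
          ∃ y z, fact (v 0) y z ∈ D) ∨
      ((¬ ∃ z, (∃ x y, fact x y z ∈ D) ∧
        ∀ x y z', fact x y z' ∈ D → z' = z ∧ ∃ w, fact y w z' ∈ D) ∧ v 0 = c) := by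
    intro v
    set A := (select c).adomWith D
    have hex : (FOFormula.ex 1 (.ex 2 (rel U 0 1 2))).Holds A D v ↔
        ∃ y z, fact (v 0) y z ∈ D := by
      simp only [Holds, holds_rel, Function.update_self, ne_eq, Function.update_of_ne,
        OfNat.zero_ne_ofNat, zero_ne_one, OfNat.one_ne_ofNat, not_false_eq_true]
      constructor
      · rintro ⟨y, -, z, -, h⟩
        exact ⟨y, z, h⟩
      · rintro ⟨y, z, h⟩
        have hm := fact_mem_adom h
        exact ⟨y, hA hm.2.1, z, hA hm.2.2, h⟩
    rw [← hex, ← holds_closed hA (v := v)]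
    rfl
  simp only [hholds]
  constructor
  · rintro ⟨-, v, rfl, h⟩
    exact h
  · intro h
    refine ⟨?_, fun _ => a, rfl, h⟩
    rcases h with ⟨-, y, z, h⟩ | ⟨-, rfl⟩
    · exact hA (fact_mem_adom h).1
    · exact hc

variable (e : U ≃ Σ n : ℕ, Fin (n + 1))

/-- The number of the cycle containing `a`. -/
def idx (a : U) : ℕ := (e a).1

/-- The successor of `a` on its cycle. -/
def next (a : U) : U := e.symm ⟨(e a).1, (e a).2 + 1⟩

/-- The base point of the `n`-th cycle. -/
def base (n : ℕ) : U := e.symm ⟨n, 0⟩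

/-- The fact recording the successor of `a` and the base point of its cycle. -/
def edge (a : U) : DBFact U ternarySchema := fact a (next e a) (base e (idx e a))

/-- The elements of the `n`-th cycle. -/
def cycle (n : ℕ) : Finset U :=
  Finset.univ.map ((Function.Embedding.sigmaMk n).trans e.symm.toEmbedding)

theorem card_cycle (n : ℕ) : (cycle e n).card = n + 1 := by
  simp [cycle]

theorem mem_cycle {n : ℕ} {a : U} : a ∈ cycle e n ↔ idx e a = n := by
  simp only [cycle, Finset.mem_map, Finset.mem_univ, true_and, Function.Embedding.trans_apply,
    Function.Embedding.sigmaMk_apply, Equiv.coe_toEmbedding, idx]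
  constructor
  · rintro ⟨i, rfl⟩
    simp
  · rintro rfl
    exact ⟨(e a).2, by simp⟩

theorem base_injective : Function.Injective (base e) := by
  intro m n h
  exact congrArg Sigma.fst (e.symm.injective h)

theorem next_symm (n : ℕ) (i : Fin (n + 1)) :
    next e (e.symm ⟨n, i⟩) = e.symm ⟨n, i + 1⟩ :=
  congrArg (fun p : Σ n : ℕ, Fin (n + 1) => e.symm ⟨p.1, p.2 + 1⟩) (e.apply_symm_apply ⟨n, i⟩)

theorem idx_next (a : U) : idx e (next e a) = idx e a := by
  simp [idx, next]

theorem idx_base (n : ℕ) : idx e (base e n) = n := by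
  simp [idx, base]

/-- Cycle 0 is a single point, so the fallback output `{base e 0}` is itself one of the worlds. -/
theorem eq_base_zero {a : U} : idx e a = 0 ↔ a = base e 0 := by
  rw [← mem_cycle]
  simp [cycle, base]

theorem fact_eq_edge {a x y z : U} (h : fact x y z = edge e a) :
    x = a ∧ y = next e a ∧ z = base e (idx e a) := by
  have h' : (![x, y, z] : Fin 3 → U) = ![a, next e a, base e (idx e a)] :=
    eq_of_heq (DBFact.ext_iff.1 h).2
  exact ⟨congrFun h' 0, congrFun h' 1, congrFun h' 2⟩

open Fin.CommRing in
/-- A nonempty subset of a cycle that is closed under successors is the whole cycle. -/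
theorem mem_of_next_closed {P : U → Prop} {a b : U} (ha : P a) (h : ∀ x, P x → P (next e x))
    (hab : idx e b = idx e a) : P b := by
  obtain ⟨⟨n, i⟩, rfl⟩ := e.symm.surjective b
  obtain ⟨⟨m, j⟩, rfl⟩ := e.symm.surjective a
  simp only [idx, Equiv.apply_symm_apply] at hab
  subst hab
  -- Iterating the successor adds `1` in `Fin (n + 1)`, so `i - j` iterations lead from `j` to `i`.
  have hk : ∀ k : ℕ, P (e.symm ⟨n, j + (k : Fin (n + 1))⟩) := by
    intro k
    induction k with
    | zero => simpa using ha
    | succ k ih =>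
      have := h _ ih
      rwa [next_symm, add_assoc, ← Nat.cast_succ] at this
  simpa using hk (i - j).val

/-- The `n`-th output instance. -/
def world (n : ℕ) : DBInstance U unarySchema := (cycle e n).map ⟨ufact, ufact_injective⟩

theorem card_world (n : ℕ) : (world e n).card = n + 1 := by
  rw [world, Finset.card_map, card_cycle]

theorem ufact_mem_world {n : ℕ} {a : U} : ufact a ∈ world e n ↔ idx e a = n := by
  rw [← mem_cycle]
  exact Finset.mem_map' ⟨ufact, ufact_injective⟩

theorem eq_world {I : DBInstance U unarySchema} {n : ℕ}
    (h : ∀ a, ufact a ∈ I ↔ idx e a = n) : I = world e n := by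
  ext f
  rw [← ufact_args f, h, ufact_mem_world]

theorem world_injective : Function.Injective (world e) := fun m n h => by
  simpa [card_world] using congrArg Finset.card h

theorem adom_world (n : ℕ) : adom (world e n) ⊆ {a | idx e a = n} := by
  intro a ha
  simp only [adom, Set.mem_iUnion, Set.mem_range] at ha
  obtain ⟨f, hf, i, rfl⟩ := ha
  have hi : i = (0 : Fin 1) := Subsingleton.elim (α := Fin 1) _ _
  rw [← ufact_args f, ufact_mem_world] at hf
  rw [hi]
  exact hf

theorem fact_mem_iff {I : DBInstance U ternarySchema} (hI : ∀ f ∈ I, f ∈ Set.range (edge e))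
    {x y z : U} : fact x y z ∈ I ↔ edge e x ∈ I ∧ y = next e x ∧ z = base e (idx e x) := by
  constructor
  · intro h
    obtain ⟨a, ha⟩ := hI _ h
    obtain ⟨rfl, rfl, rfl⟩ := fact_eq_edge e ha.symm
    exact ⟨ha ▸ h, rfl, rfl⟩
  · rintro ⟨h, rfl, rfl⟩
    exact h

/-- Equal base points confine the edges to one cycle, and closure under successors fills it up. -/
theorem closed_iff {I : DBInstance U ternarySchema} (hI : ∀ f ∈ I, f ∈ Set.range (edge e)) :
    (∃ z, (∃ x y, fact x y z ∈ I) ∧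
      ∀ x y z', fact x y z' ∈ I → z' = z ∧ ∃ w, fact y w z' ∈ I) ↔
    ∃ n, ∀ a, edge e a ∈ I ↔ idx e a = n := by
  simp only [fact_mem_iff e hI]
  constructor
  · rintro ⟨z, ⟨x, y, hx, rfl, rfl⟩, h⟩
    refine ⟨idx e x, fun a => ⟨fun ha => ?_, fun ha => ?_⟩⟩
    · exact base_injective e (h a _ _ ⟨ha, rfl, rfl⟩).1
    · refine mem_of_next_closed e (P := fun a => edge e a ∈ I) hx (fun b hb => ?_) ha
      obtain ⟨-, w, hw, -⟩ := h b _ _ ⟨hb, rfl, rfl⟩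
      exact hw
  · rintro ⟨n, hn⟩
    refine ⟨base e n, ⟨base e n, _, (hn _).2 (idx_base e n), rfl, by rw [idx_base]⟩, ?_⟩
    rintro x _ _ ⟨hx, rfl, rfl⟩
    have := (hn x).1 hx
    exact ⟨by rw [this], _, (hn _).2 (by rw [idx_next, this]), rfl, by rw [idx_next]⟩

theorem view_apply_of_cycle {I : DBInstance U ternarySchema}
    (hI : ∀ f ∈ I, f ∈ Set.range (edge e)) {n : ℕ} (hn : ∀ a, edge e a ∈ I ↔ idx e a = n) :
    (view (base e 0)).apply I = world e n := by
  refine eq_world e fun a => ?_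
  rw [ufact_mem_view, closed_iff e hI]
  have hex : ∃ n, ∀ a, edge e a ∈ I ↔ idx e a = n := ⟨n, hn⟩
  simp only [hex, fact_mem_iff e hI, not_true, true_and, false_and, or_false, ← hn a]
  exact ⟨fun ⟨_, _, h, _⟩ => h, fun h => ⟨_, _, h, rfl, rfl⟩⟩

theorem exists_view_apply_eq_world {I : DBInstance U ternarySchema}
    (hI : ∀ f ∈ I, f ∈ Set.range (edge e)) :
    ∃ n, (view (base e 0)).apply I = world e n := by
  by_cases hex : ∃ n, ∀ a, edge e a ∈ I ↔ idx e a = n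
  · obtain ⟨n, hn⟩ := hex
    exact ⟨n, view_apply_of_cycle e hI hn⟩
  · refine ⟨0, eq_world e fun a => ?_⟩
    rw [ufact_mem_view, closed_iff e hI, eq_base_zero]
    simp [hex]

theorem exists_view_apply_eq (n : ℕ) :
    ∃ I : DBInstance U ternarySchema, (∀ f ∈ I, f ∈ Set.range (edge e)) ∧
      (view (base e 0)).apply I = world e n := by
  classical
  have hI : ∀ f ∈ (cycle e n).image (edge e), f ∈ Set.range (edge e) := by
    intro f hf
    obtain ⟨a, -, rfl⟩ := Finset.mem_image.1 hf
    exact ⟨a, rfl⟩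
  refine ⟨_, hI, view_apply_of_cycle e hI fun a => ?_⟩
  rw [Finset.mem_image, ← mem_cycle]
  constructor
  · rintro ⟨b, hb, hba⟩
    exact (fact_eq_edge e hba).1 ▸ hb
  · intro ha
    exact ⟨a, ha, rfl⟩

end Cycles

end ProbDB

/-! ### The separating PDB and the main theorem -/

namespace ProbDB

namespace Cycles

variable {U : Type*} [Countable U] (e : U ≃ Σ n : ℕ, Fin (n + 1))

/-- Facts that are not edges get weight zero, so they occur in no possible world. -/
theorem exists_weights : ∃ q : DBFact U ternarySchema → ℝ≥0∞,
    ∑' f, q f ≠ ∞ ∧ ∀ f, q f ≠ 0 ↔ f ∈ Set.range (edge e) := by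
  obtain ⟨q, hq, hs⟩ := ENNReal.exists_pos_sum_of_countable' one_ne_zero (DBFact U ternarySchema)
  refine ⟨(Set.range (edge e)).indicator q, ?_, fun f => ?_⟩
  · refine ne_top_of_le_ne_top (hs.trans ENNReal.one_lt_top).ne
      (ENNReal.tsum_le_tsum fun f => Set.indicator_le_self _ _ _)
  · simp [(hq f).ne']

/-- There is a tuple-independent PDB whose possible worlds are the finite sets of edges. -/
theorem exists_isTI : ∃ I : PDB U ternarySchema, I.IsTI ∧ I.space = I.worlds ∧
    ∀ S, S ∈ I.worlds ↔ ∀ f ∈ S, f ∈ Set.range (edge e) := by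
  obtain ⟨q, hs, hq⟩ := exists_weights e
  refine ⟨⟨(finsetPMF q hs).support, finsetPMF q hs, subset_rfl⟩,
    fun F _ => finsetPMF_subset hs F, rfl, fun S => ?_⟩
  refine (finsetPMF_apply_ne_zero_iff hs S).trans ?_
  simp only [hq]

end Cycles

open Cycles in
/-- There is a domain-disjoint PDB in `FO(TI)` with nonempty possible worlds of unbounded size. -/
theorem exists_domainDisjoint_mem_FO_TI (U : Type*) [Countable U] [Infinite U] :
    ∃ D : PDB U unarySchema, (⟨unarySchema, D⟩ : Σ τ : Schema, PDB U τ) ∈ FO (TI U) ∧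
      D.IsDomainDisjoint ∧ ∃ W : ℕ+ → DBInstance U unarySchema,
        Function.Injective W ∧ D.worlds = Set.range W ∧ ∀ n : ℕ+, (n : ℕ) ≤ (W n).card := by
  have : Infinite (Σ n : ℕ, Fin (n + 1)) :=
    Infinite.of_injective (fun n : ℕ => (⟨n, 0⟩ : Σ n : ℕ, Fin (n + 1)))
      fun m n h => congrArg Sigma.fst h
  obtain ⟨e⟩ := nonempty_equiv_of_countable (α := U) (β := Σ n : ℕ, Fin (n + 1))
  obtain ⟨I, hI, hIs, hIw⟩ := exists_isTI e
  set V := view (base e 0) with hV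
  have hmaps : ∀ S ∈ I.worlds, V.apply S ∈ Set.range (world e) := fun S hS => by
    obtain ⟨n, hn⟩ := exists_view_apply_eq_world e ((hIw S).1 hS)
    exact ⟨n, hn.symm⟩
  let D : PDB U unarySchema :=
    { space := Set.range (world e)
      law := I.law.map V.apply
      support_subset := by
        intro J hJ
        obtain ⟨S, hS, rfl⟩ := (PMF.mem_support_map_iff _ _ _).1 hJ
        exact hmaps S hS }
  have hD : D.worlds = Set.range (world e) := by
    refine D.support_subset.antisymm ?_
    rintro _ ⟨n, rfl⟩
    obtain ⟨S, hS, hSn⟩ := exists_view_apply_eq e n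
    exact (PMF.mem_support_map_iff _ _ _).2 ⟨S, (hIw S).2 hS, hSn⟩
  -- Cycle `n` has `n + 1` elements, so shifting the index by one gives `W n` exactly `n` facts.
  refine ⟨D, ⟨⟨ternarySchema, I⟩, hI, V, ?_, ?_⟩, ?_, fun n => world e n.natPred, ?_, ?_, ?_⟩
  · intro S hS
    exact hmaps S (hIs ▸ hS)
  · intro J _
    change I.law.map V.apply J = _
    rw [← PMF.toOuterMeasure_apply_singleton, PMF.toOuterMeasure_map_apply, PDB.prob]
    refine PMF.toOuterMeasure_apply_eq_of_inter_support_eq _ (Set.ext fun S => ?_)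
    refine ⟨fun h => ⟨⟨I.support_subset h.2, h.1⟩, h.2⟩, fun h => ⟨h.1.2, h.2⟩⟩
  · rintro _ ⟨m, rfl⟩ _ ⟨n, rfl⟩ hmn
    refine Set.disjoint_left.2 fun a ha hb => hmn ?_
    rw [← adom_world e m ha, ← adom_world e n hb]
  · exact (world_injective e).comp PNat.natPred_injective
  · rw [hD]
    ext J
    constructor
    · rintro ⟨n, rfl⟩
      exact ⟨n.succPNat, by simp⟩
    · rintro ⟨n, rfl⟩
      exact ⟨_, rfl⟩
  · intro n
    rw [card_world, PNat.natPred_add_one]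

theorem FO_mono {U : Type*} {𝓒 𝓓 : PDBClass U} (h : 𝓒 ⊆ 𝓓) : FO 𝓒 ⊆ FO 𝓓 :=
  fun _ ⟨I, hI, V, hV⟩ => ⟨I, h hI, V, hV⟩

theorem UCQ_subset_FO {U : Type*} (𝓒 : PDBClass U) : UCQ 𝓒 ⊆ FO 𝓒 :=
  fun _ ⟨I, hI, V, _, hV⟩ => ⟨I, hI, V, hV⟩

theorem TI_subset_BID (U : Type*) : TI U ⊆ BID U :=
  fun _ hD => PDB.IsTI.isBID hD

end ProbDB

theorem mainTheorem9 (U : Type*) [Countable U] [Infinite U] :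
    ProbDB.UCQ (ProbDB.BID U) ⊂ ProbDB.FO (ProbDB.BID U) ∧
    ∃ D : ProbDB.PDB U ProbDB.unarySchema,
      (⟨ProbDB.unarySchema, D⟩ : Σ τ : ProbDB.Schema, ProbDB.PDB U τ) ∈
        ProbDB.FO (ProbDB.TI U) ∧
      D.IsDomainDisjoint ∧
      (∃ W : ℕ+ → ProbDB.DBInstance U ProbDB.unarySchema,
        Function.Injective W ∧ D.worlds = Set.range W ∧ ∀ n : ℕ+, (n : ℕ) ≤ (W n).card) ∧
      (⟨ProbDB.unarySchema, D⟩ : Σ τ : ProbDB.Schema, ProbDB.PDB U τ) ∉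
        ProbDB.UCQ (ProbDB.BID U) := by
  obtain ⟨D, hTI, hdisj, W, hinj, hW, hcard⟩ := ProbDB.exists_domainDisjoint_mem_FO_TI U
  have hnot : (⟨ProbDB.unarySchema, D⟩ : Σ τ : ProbDB.Schema, ProbDB.PDB U τ) ∉
      ProbDB.UCQ (ProbDB.BID U) := by
    refine ProbDB.PDB.notMem_UCQ_BID hdisj ?_ fun k => ?_
    · rw [hW]
      rintro _ ⟨n, rfl⟩
      exact Finset.card_pos.1 (n.pos.trans_le (hcard n))
    · exact ⟨W k.succPNat, hW ▸ ⟨_, rfl⟩, hcard k.succPNat⟩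
  refine ⟨⟨ProbDB.UCQ_subset_FO _, fun h => hnot (h ?_)⟩, D, hTI, hdisj, ⟨W, hinj, hW, hcard⟩, hnot⟩
  exact ProbDB.FO_mono (ProbDB.TI_subset_BID U) hTI
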